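/- **Model.** Consider a queue with room for at most $l_M$ waiting jobs, arrival rate $\lambda>0$ and two exponential servers with rates $\mu_1\ge\mu_2>0$ (server 1 fast, server 2 slow), uniformized to a discrete-time Markov decision process. A state is $s=(l,b_1,b_2)$ with $0\le l\le l_M$ waiting jobs and $b_i=1$ if server $i$ is busy; its cost is $c(s)=l+b_1+b_2$. Action $a=0$ waits and action $a=i$ routes a waiting job to server $i$ (without effect if server $i$ is busy or $l=0$). After the action the next event is an arrival (lost if the queue is full) or a service event at server 1 or 2 (without effect if the server is idle), with probabilities proportional to $\lambda,\mu_1,\mu_2$. Let $0<\gamma<1$ be the discount factor, $\xi$ the initial distribution, $\Pi$ the set of all stationary randomized policies, $V^\pi(s)=\mathbb E_\pi[\sum_{t\ge0}\gamma^tc(s_t)\mid s_0=s]$, $Q^\pi(s,a)=c(s)+\gamma\sum_{s'}\Pr(s'\mid s,a)V^\pi(s')$, $V^\star=\inf_\pi V^\pi$, $J_\gamma(\pi)=\mathbb E_{s\sim\xi}V^\pi(s)$ and $J_\gamma(\pi^\star)=\inf_{\pi\in\Pi}J_\gamma(\pi)$. Let $T_\pi$ be the Bellman operator of $\pi$ and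 $T$ the Bellman optimality operator. **Policies.** For $\sigma>0$ and $\theta\in\mathbb R$ the soft threshold policy $\pi_\theta$ uses server 1 whenever it is idle and a job waits; in state $(l,1,0)$ it routes a job to server 2 with probability $e^{\sigma(l-\theta)}/(1+e^{\sigma(l-\theta)})$; otherwise it waits. The hard threshold policy with threshold $n\in\mathbb N$ does the same, except that in state $(l,1,0)$ it routes to server 2 if and only if $l>n$. Let $\nu_\theta=(1-\gamma)\sum_{t\ge0}\gamma^t\Pr_{\pi_\theta}(s_t=\cdot\mid s_0\sim\xi)$ and $\mathcal B_\theta(\pi)=\mathbb E_{s\sim\nu_\theta}[(T_{\pi}V^{\pi_\theta})(s)]$. Let $\kappa_\xi$ be the smallest $\kappa\ge0$ with $\|V-V^\star\|_{1,\xi}\le\frac{\kappa}{1-\gamma}\|V-TV\|_{1,\xi}$ for all $V\in\{V^{\pi_\theta}:\theta\in\mathbb R\}$, where $\|V\|_{1,\xi}=\mathbb E_{s\sim\xi}|V(s)|$. Say that $\varepsilon_b\ge0$ is an inherent Bellman error at $\theta$ if $\inf_{\theta^+\in\mathbb R}\mathcal B_\theta(\pi_{\theta^+})\le\inf_{\pi\in\Pi}\mathcal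 B_\theta(\pi)+\varepsilon_b$. **Theorem.** For every $\sigma>0$: 1. $\theta\mapsto J_\gamma(\pi_\theta)$ is continuously differentiable, and so are, for every $\theta$, the maps $\bar\theta\mapsto\mathbb E_{s\sim\nu_\theta}[(T_{\pi_{\bar\theta}}V^{\pi_\theta})(s)]$ and $\bar\theta\mapsto\mathbb E_{s\sim\nu_{\bar\theta}}[(T_{\pi_\theta}V^{\pi_\theta})(s)]$. 2. There is a finite $\varepsilon_b\ge0$ that is an inherent Bellman error at every $\theta$. 3. If for some $n\in\mathbb N$ one has $Q^{\pi_\theta}((l,1,0),0)\le Q^{\pi_\theta}((l,1,0),2)$ for $1\le l\le n$ and $Q^{\pi_\theta}((l,1,0),2)\le Q^{\pi_\theta}((l,1,0),0)$ for $l>n$, then $\bar\theta\mapsto\mathcal B_\theta(\pi_{\bar\theta})$ has no sub-optimal stationary points, that is, each of its stationary points minimizes it over $\mathbb R$. 4. Suppose that $\kappa_\xi$ exists. If $\theta$ is a stationary point of $\theta\mapsto J_\gamma(\pi_\theta)$, if $\bar\theta\mapsto\mathcal B_\theta(\pi_{\bar\theta})$ has no sub-optimal stationary points, and if $\varepsilon_b$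 is an inherent Bellman error at $\theta$, then $$(1-\gamma)\bigl(J_\gamma(\pi_\theta)-J_\gamma(\pi^\star)\bigr)\le\frac{\kappa_\xi}{1-\gamma}\,\varepsilon_b .$$ Moreover, there are $\varepsilon_b(\sigma)\ge0$, depending on $\sigma$ but not on $\theta$, with $\varepsilon_b(\sigma)\to0$ as $\sigma\to\infty$, such that $\varepsilon_b(\sigma)$ is an inherent Bellman error at every $\theta$ for which some hard threshold policy minimizes $\mathcal B_\theta$ over $\Pi$. -/

import Mathlib

open Filter Topology

noncomputable section

namespace TwoServer

/-- A two-server queue with discounted cost: a buffer for at most `cap` jobs, Poisson arrivals of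
rate `arr`, exponential services of rate `fast` (server 1) and `slow` (server 2), and a discount
factor `disc`. -/
structure Queue where
  cap : ℕ
  arr : ℝ
  fast : ℝ
  slow : ℝ
  disc : ℝ
  arr_pos : 0 < arr
  slow_pos : 0 < slow
  slow_le_fast : slow ≤ fast
  disc_pos : 0 < disc
  disc_lt_one : disc < 1

/-- A state `(l, b₁, b₂)`: `l` jobs wait in the queue, and `bᵢ = true` iff server `i` is busy. -/
abbrev State (M : Queue) : Type := Fin (M.cap + 1) × Bool × Bool

/-- Action `0` keeps the jobs in the queue, action `i ∈ {1, 2}` routes a job to server `i`. -/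
abbrev Action : Type := Fin 3

variable (M : Queue)

/-- The cost of a state: the number of jobs in the system. -/
def cost (s : State M) : ℝ :=
  (s.1 : ℕ) + (if s.2.1 then 1 else 0) + (if s.2.2 then 1 else 0)

/-- The state right after the routing decision. Routing to a busy server, or from an empty queue,
has no effect. -/
def dispatch (s : State M) (a : Action) : State M :=
  if a = 1 ∧ 0 < (s.1 : ℕ) ∧ s.2.1 = false then
    (⟨(s.1 : ℕ) - 1, lt_of_le_of_lt (Nat.sub_le _ _) s.1.isLt⟩, true, s.2.2)
  else if a = 2 ∧ 0 < (s.1 : ℕ) ∧ s.2.2 = false then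
    (⟨(s.1 : ℕ) - 1, lt_of_le_of_lt (Nat.sub_le _ _) s.1.isLt⟩, s.2.1, true)
  else s

/-- An arrival; the job is lost if the buffer is full. -/
def arrive (s : State M) : State M :=
  (⟨min ((s.1 : ℕ) + 1) M.cap, Nat.lt_succ_of_le (min_le_right _ _)⟩, s.2)

/-- A service event at server 1; nothing happens if the server is idle. -/
def departFast (s : State M) : State M := (s.1, false, s.2.2)

/-- A service event at server 2; nothing happens if the server is idle. -/
def departSlow (s : State M) : State M := (s.1, s.2.1, false)

/-- The transition probabilities `Pr(s' | s, a)` of the uniformized queue: after the routing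
decision, the next event is an arrival or a service event, with probabilities proportional to the
rates. -/
def trans (s : State M) (a : Action) (s' : State M) : ℝ :=
  (M.arr * (if s' = arrive M (dispatch M s a) then 1 else 0)
    + M.fast * (if s' = departFast M (dispatch M s a) then 1 else 0)
    + M.slow * (if s' = departSlow M (dispatch M s a) then 1 else 0))
    / (M.arr + M.fast + M.slow)

/-- The set of all (stationary, randomized) policies; `prob s a` is the probability of taking
action `a` in state `s`. -/
structure Policy where
  prob : State M → Action → ℝ
  nonneg : ∀ s a, 0 ≤ prob s a
  sum_one : ∀ s, ∑ a, prob s a = 1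

/-- The transition matrix of the Markov chain induced by a policy. -/
def transMatrix (p : Policy M) : Matrix (State M) (State M) ℝ :=
  Matrix.of fun s s' => ∑ a, p.prob s a * trans M s a s'

/-- The value function `V^π(s) = E[∑ₜ γᵗ c(sₜ) | s₀ = s]`; here `E[c(sₜ) | s₀ = s]` is the entry
at `s` of the `t`-th power of the transition matrix applied to the cost vector. -/
def value (p : Policy M) (s : State M) : ℝ :=
  ∑' t : ℕ, M.disc ^ t * ((transMatrix M p ^ t).mulVec (cost M)) s

/-- The discounted cost `J_γ(π) = E_{s ∼ ξ}[V^π(s)]`. -/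
def J (ξ : State M → ℝ) (p : Policy M) : ℝ := ∑ s, ξ s * value M p s

/-- The optimal cost `J_γ(π*) = min_π J_γ(π)`, over all policies. -/
def Jopt (ξ : State M → ℝ) : ℝ := ⨅ p : Policy M, J M ξ p

/-- The optimal value function `V*`. -/
def valueOpt (s : State M) : ℝ := ⨅ p : Policy M, value M p s

/-- The action values of a function `V`: `c(s) + γ ∑ₛ' Pr(s' | s, a) V(s')`. For `V = V^π` this is
`Q^π(s, a)`. -/
def qValue (V : State M → ℝ) (s : State M) (a : Action) : ℝ :=
  cost M s + M.disc * ∑ s', trans M s a s' * V s'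

/-- The Bellman operator `T_π` of a policy. -/
def bellmanPolicy (p : Policy M) (V : State M → ℝ) (s : State M) : ℝ :=
  ∑ a, p.prob s a * qValue M V s a

/-- The Bellman optimality operator `T`. -/
def bellman (V : State M → ℝ) (s : State M) : ℝ := ⨅ a : Action, qValue M V s a

/-- The weighted policy iteration objective `B(π | ν, V) = E_{s ∼ ν}[(T_π V)(s)]`. -/
def B (p : Policy M) (ν V : State M → ℝ) : ℝ := ∑ s, ν s * bellmanPolicy M p V s

/-- The weighted norm `‖V‖_{1,ξ}`. -/
def norm1 (ξ V : State M → ℝ) : ℝ := ∑ s, ξ s * |V s|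

/-- The state distribution `ν_π` induced by a policy in the discounted problem, the probability
distribution `(1 - γ) ∑ₜ γᵗ Pr(sₜ = · | s₀ ∼ ξ)`. It is the stationary distribution of the chain
that follows `π` and that restarts from `ξ` with probability `1 - γ` at each step. -/
def occupancy (ξ : State M → ℝ) (p : Policy M) (s : State M) : ℝ :=
  (1 - M.disc) * ∑' t : ℕ, M.disc ^ t * (Matrix.vecMul ξ (transMatrix M p ^ t)) s

/-- The policy that always uses server 1 if it is idle and a job waits, and that, if server 1 is
busy, server 2 is idle and `l` jobs wait, routes a job to server 2 with probability `r l`. -/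
def fastFirst (r : ℕ → ℝ) (hr : ∀ l, 0 ≤ r l ∧ r l ≤ 1) : Policy M where
  prob s a :=
    if s.2.1 = false then
      if 0 < (s.1 : ℕ) then (if a = 1 then 1 else 0) else (if a = 0 then 1 else 0)
    else if s.2.2 = false then
      (if a = 2 then r s.1 else if a = 0 then 1 - r s.1 else 0)
    else (if a = 0 then 1 else 0)
  nonneg s a := by
    have h1 := (hr s.1).1
    have h2 := (hr s.1).2
    split_ifs <;> linarith
  sum_one s := by
    split_ifs <;> simp [Fin.sum_univ_three]

/-- The soft threshold policy `π_θ` with sharpness `σ`. -/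
def soft (σ θ : ℝ) : Policy M :=
  fastFirst M (fun l => Real.exp (σ * (l - θ)) / (1 + Real.exp (σ * (l - θ)))) (fun l => by
    have h := Real.exp_pos (σ * ((l : ℝ) - θ))
    exact ⟨by positivity, (div_le_one (by positivity)).2 (by linarith)⟩)

/-- The hard threshold policy, which uses server 2 iff more than `n` jobs wait. -/
def hard (n : ℕ) : Policy M :=
  fastFirst M (fun l => if n < l then 1 else 0) (fun l => by split_ifs <;> simp)

/-- The weighted policy iteration objective at the soft threshold policy `π_θ`, that is
`B(π | ν_θ, V^θ)`. -/
def piObjective (σ : ℝ) (ξ : State M → ℝ) (θ : ℝ) (p : Policy M) : ℝ :=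
  B M p (occupancy M ξ (soft M σ θ)) (value M (soft M σ θ))

/-- `κ` is the effective concentrability coefficient of the value functions of the soft threshold
policies: the smallest nonnegative scalar with `‖V - V*‖ ≤ κ / (1 - γ) * ‖V - T V‖` for all of
them. -/
def IsConcentrability (σ : ℝ) (ξ : State M → ℝ) (κ : ℝ) : Prop :=
  IsLeast {k : ℝ | 0 ≤ k ∧ ∀ θ : ℝ,
    norm1 M ξ (fun s => value M (soft M σ θ) s - valueOpt M s) ≤
      k / (1 - M.disc) *
        norm1 M ξ (fun s => value M (soft M σ θ) s - bellman M (value M (soft M σ θ)) s)} κ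

/-- Closure under policy improvement at `π_θ` up to the error `ε`. -/
def ClosedUpTo (σ : ℝ) (ξ : State M → ℝ) (θ ε : ℝ) : Prop :=
  (⨅ x : ℝ, piObjective M σ ξ θ (soft M σ x)) ≤ (⨅ p : Policy M, piObjective M σ ξ θ p) + ε

/-- The weighted policy iteration objective at `π_θ`, as a function of the parameter of a soft
threshold policy, has no sub-optimal stationary points. -/
def NoSuboptimalStationary (σ : ℝ) (ξ : State M → ℝ) (θ : ℝ) : Prop :=
  ∀ x : ℝ, deriv (fun y => piObjective M σ ξ θ (soft M σ y)) x = 0 →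
    ∀ y : ℝ, piObjective M σ ξ θ (soft M σ x) ≤ piObjective M σ ξ θ (soft M σ y)

/-- Some hard threshold policy is a policy improvement of `π_θ` among all policies. -/
def ThresholdImproves (σ : ℝ) (ξ : State M → ℝ) (θ : ℝ) : Prop :=
  ∃ n : ℕ, ∀ p : Policy M, piObjective M σ ξ θ (hard M n) ≤ piObjective M σ ξ θ p

/-- With server 1 busy, server 2 idle and `l ≥ 1` waiting jobs, the action values of `π_θ` prefer
waiting for `l ≤ n` and prefer routing to server 2 for `l > n`, for some `n`. -/
def SingleCrossing (σ : ℝ) (θ : ℝ) : Prop :=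
  ∃ n : ℕ, ∀ l : Fin (M.cap + 1), 1 ≤ (l : ℕ) →
    ((l : ℕ) ≤ n → qValue M (value M (soft M σ θ)) (l, true, false) 0 ≤
      qValue M (value M (soft M σ θ)) (l, true, false) 2) ∧
    (n < (l : ℕ) → qValue M (value M (soft M σ θ)) (l, true, false) 2 ≤
      qValue M (value M (soft M σ θ)) (l, true, false) 0)

end TwoServer

end

noncomputable section

namespace TwoServer

variable (M : Queue)

-- Transition matrices and their discounted resolvent, in the maximal row sum norm.

attribute [local instance] Matrix.linftyOpNormedRing Matrix.linftyOpNormedAlgebra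

/-! The transition matrix P of a policy is stochastic, so γP has row sum norm below 1 and R = (1 -
γP)⁻¹ is a convergent Neumann series. Value and occupancy are linear in R, namely Rc and (1 - γ)ξR;
smoothness in the parameter follows from smoothness of the logistic function and of matrix
inversion.

The same algebra gives the performance difference identity `sum_occupancy_mul_bellmanPolicy_sub`.
Differentiating it at θ with V = V^θ held fixed, the derivative of the occupancy is multiplied by
T_π V - V = 0, so J and the policy iteration objective have proportional derivatives at θ
(`deriv_J_soft`). A stationary point of J is therefore stationary for the objective, hence a
minimizer if there are no sub-optimal ones. Comparison with the greedy policy bounds the Bellman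
residual V - TV under ν_θ by ε_b; since ν_θ ≥ (1 - γ)ξ, it is controlled under ξ, and the
concentrability coefficient turns it into an optimality gap.

For single crossing, the derivative of the objective is -σ times a combination of logistic densities
whose weights change sign once. Total positivity of these densities preserves this sign pattern, so
the objective falls before a stationary point and rises after it. The vanishing error comes from
approximating hard threshold n by the soft policy at n + 1/2. -/

lemma rates_pos : 0 < M.arr + M.fast + M.slow := by
  have h1 := M.arr_pos
  have h2 := M.slow_pos
  have h3 := M.slow_le_fast
  linarith

lemma trans_nonneg (s : State M) (a : Action) (s' : State M) : 0 ≤ trans M s a s' := by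
  have h1 := M.arr_pos
  have h2 := M.slow_pos
  have h3 := h2.trans_le M.slow_le_fast
  unfold trans
  positivity

lemma sum_trans (s : State M) (a : Action) : ∑ s', trans M s a s' = 1 := by
  unfold trans
  rw [← Finset.sum_div, Finset.sum_add_distrib, Finset.sum_add_distrib, ← Finset.mul_sum,
    ← Finset.mul_sum, ← Finset.mul_sum]
  simp only [Finset.sum_ite_eq', Finset.mem_univ, if_true, mul_one]
  exact div_self (rates_pos M).ne'

lemma transMatrix_apply (p : Policy M) (s s' : State M) :
    transMatrix M p s s' = ∑ a, p.prob s a * trans M s a s' := rfl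

lemma transMatrix_nonneg (p : Policy M) (s s' : State M) : 0 ≤ transMatrix M p s s' := by
  rw [transMatrix_apply]
  exact Finset.sum_nonneg fun a _ => mul_nonneg (p.nonneg s a) (trans_nonneg M s a s')

lemma sum_transMatrix (p : Policy M) (s : State M) : ∑ s', transMatrix M p s s' = 1 := by
  simp only [transMatrix_apply]
  rw [Finset.sum_comm]
  simp only [← Finset.mul_sum, sum_trans, mul_one, p.sum_one]

lemma norm_transMatrix_le (p : Policy M) : ‖transMatrix M p‖ ≤ 1 := by
  rw [Matrix.linfty_opNorm_def]
  rw [NNReal.coe_le_one]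
  refine Finset.sup_le fun s _ => ?_
  rw [← NNReal.coe_le_coe]
  push_cast
  rw [← sum_transMatrix M p s]
  exact Finset.sum_le_sum fun s' _ => by
    rw [Real.norm_of_nonneg (transMatrix_nonneg M p s s')]

lemma norm_disc_smul_transMatrix_lt (p : Policy M) : ‖M.disc • transMatrix M p‖ < 1 := by
  rw [norm_smul, Real.norm_of_nonneg M.disc_pos.le]
  nlinarith [norm_transMatrix_le M p, M.disc_pos, M.disc_lt_one, norm_nonneg (transMatrix M p)]

instance completeSpace_matrix : CompleteSpace (Matrix (State M) (State M) ℝ) :=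
  FiniteDimensional.complete ℝ _

/-- The discounted sum `∑ₜ γᵗ Pᵗ` of the powers of the transition matrix. -/
def resolvent (p : Policy M) : Matrix (State M) (State M) ℝ :=
  ∑' t : ℕ, (M.disc • transMatrix M p) ^ t

lemma hasSum_resolvent (p : Policy M) :
    HasSum (fun t : ℕ => (M.disc • transMatrix M p) ^ t) (resolvent M p) :=
  (summable_geometric_of_norm_lt_one (norm_disc_smul_transMatrix_lt M p)).hasSum

lemma resolvent_mul (p : Policy M) :
    resolvent M p * (1 - M.disc • transMatrix M p) = 1 :=
  geom_series_mul_neg _ (norm_disc_smul_transMatrix_lt M p)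

lemma mul_resolvent (p : Policy M) :
    (1 - M.disc • transMatrix M p) * resolvent M p = 1 :=
  mul_neg_geom_series _ (norm_disc_smul_transMatrix_lt M p)

lemma hasSum_linear (p : Policy M) (f : Matrix (State M) (State M) ℝ →ₗ[ℝ] ℝ) :
    HasSum (fun t : ℕ => M.disc ^ t * f (transMatrix M p ^ t)) (f (resolvent M p)) := by
  have h := (hasSum_resolvent M p).mapL (LinearMap.toContinuousLinearMap f)
  simpa [smul_pow] using h

/-- The entry at `s` of the product of a matrix with the vector `v`, as a function of the
matrix. -/
def mulVecEntry (v : State M → ℝ) (s : State M) : Matrix (State M) (State M) ℝ →ₗ[ℝ] ℝ where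
  toFun A := A.mulVec v s
  map_add' A B := by simp [Matrix.add_mulVec]
  map_smul' c A := by simp [Matrix.smul_mulVec]

/-- The entry at `s` of the product of the vector `v` with a matrix, as a function of the
matrix. -/
def vecMulEntry (v : State M → ℝ) (s : State M) : Matrix (State M) (State M) ℝ →ₗ[ℝ] ℝ where
  toFun A := Matrix.vecMul v A s
  map_add' A B := by simp [Matrix.vecMul_add]
  map_smul' c A := by simp [Matrix.vecMul_smul]

lemma value_eq (p : Policy M) : value M p = (resolvent M p).mulVec (cost M) := by
  funext s
  exact (hasSum_linear M p (mulVecEntry M (cost M) s)).tsum_eq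

lemma occupancy_eq (ξ : State M → ℝ) (p : Policy M) :
    occupancy M ξ p = (1 - M.disc) • Matrix.vecMul ξ (resolvent M p) := by
  funext s
  exact congrArg ((1 - M.disc) * ·) (hasSum_linear M p (vecMulEntry M ξ s)).tsum_eq

lemma pow_transMatrix_nonneg (p : Policy M) (t : ℕ) (s s' : State M) :
    0 ≤ (transMatrix M p ^ t) s s' := by
  induction t generalizing s s' with
  | zero => rw [pow_zero, Matrix.one_apply]; split_ifs <;> norm_num
  | succ t ih =>
    rw [pow_succ, Matrix.mul_apply]
    exact Finset.sum_nonneg fun k _ => mul_nonneg (ih s k) (transMatrix_nonneg M p k s')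

lemma resolvent_nonneg (p : Policy M) (s s' : State M) : 0 ≤ resolvent M p s s' := by
  have h := hasSum_linear M p (mulVecEntry M (Pi.single s' 1) s)
  simp only [mulVecEntry, LinearMap.coe_mk, AddHom.coe_mk, Matrix.mulVec_single_one,
    Matrix.col_apply] at h
  exact h.nonneg fun t => mul_nonneg (pow_nonneg M.disc_pos.le t) (pow_transMatrix_nonneg M p t s s')

/-- The constant vector 1 is an eigenvector of 1 - γP with eigenvalue 1 - γ, hence of its inverse.
-/
lemma sum_resolvent (p : Policy M) (s : State M) :
    ∑ s', resolvent M p s s' = (1 - M.disc)⁻¹ := by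
  have h1 : (1 - M.disc • transMatrix M p).mulVec (fun _ => 1) = fun _ => 1 - M.disc := by
    funext s
    simp [Matrix.mulVec, dotProduct, Matrix.one_apply, ← Finset.mul_sum, sum_transMatrix]
  have h2 : (resolvent M p).mulVec (fun _ => 1 - M.disc) = fun _ => 1 := by
    rw [← h1, Matrix.mulVec_mulVec, resolvent_mul, Matrix.one_mulVec]
  have h3 := congrFun h2 s
  simp only [Matrix.mulVec, dotProduct, ← Finset.sum_mul] at h3
  exact eq_inv_of_mul_eq_one_left h3

lemma resolvent_eq (p : Policy M) :
    resolvent M p = 1 + M.disc • (resolvent M p * transMatrix M p) := by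
  have h := resolvent_mul M p
  rw [mul_sub, mul_one, Matrix.mul_smul] at h
  rw [← h]
  abel

/-- The identity is the t = 0 term of a series of nonnegative matrices. -/
lemma one_le_resolvent (p : Policy M) (s s' : State M) :
    (1 : Matrix (State M) (State M) ℝ) s s' ≤ resolvent M p s s' := by
  rw [resolvent_eq, Matrix.add_apply, Matrix.smul_apply, Matrix.mul_apply]
  have : 0 ≤ M.disc • ∑ k, resolvent M p s k * transMatrix M p k s' :=
    mul_nonneg M.disc_pos.le <| Finset.sum_nonneg fun k _ =>
      mul_nonneg (resolvent_nonneg M p s k) (transMatrix_nonneg M p k s')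
  linarith

/-! ### Uniform bounds on costs and values. -/

lemma cost_nonneg (s : State M) : 0 ≤ cost M s := by
  unfold cost
  positivity

lemma cost_le (s : State M) : cost M s ≤ M.cap + 2 := by
  have h : ((s.1 : ℕ) : ℝ) ≤ M.cap := by exact_mod_cast Nat.le_of_lt_succ s.1.isLt
  unfold cost
  split_ifs <;> linarith

lemma value_nonneg (p : Policy M) (s : State M) : 0 ≤ value M p s := by
  rw [value_eq]
  exact Finset.sum_nonneg fun k _ => mul_nonneg (resolvent_nonneg M p s k) (cost_nonneg M k)

/-- An upper bound for the discounted cost of every policy. -/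
def valueBound : ℝ := (M.cap + 2) / (1 - M.disc)

lemma valueBound_nonneg : 0 ≤ valueBound M :=
  div_nonneg (by positivity) (by linarith [M.disc_lt_one])

lemma value_le (p : Policy M) (s : State M) : value M p s ≤ valueBound M := by
  rw [value_eq, valueBound, div_eq_inv_mul, ← sum_resolvent M p s, Finset.sum_mul]
  exact Finset.sum_le_sum fun k _ =>
    mul_le_mul_of_nonneg_left (cost_le M k) (resolvent_nonneg M p s k)

lemma qValue_nonneg (V : State M → ℝ) (hV : ∀ s, 0 ≤ V s) (s : State M) (a : Action) :
    0 ≤ qValue M V s a :=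
  add_nonneg (cost_nonneg M s) <| mul_nonneg M.disc_pos.le <|
    Finset.sum_nonneg fun k _ => mul_nonneg (trans_nonneg M s a k) (hV k)

lemma qValue_le (V : State M → ℝ) (hV : ∀ s, V s ≤ valueBound M) (s : State M) (a : Action) :
    qValue M V s a ≤ valueBound M := by
  have h1 : ∑ s', trans M s a s' * V s' ≤ valueBound M := by
    calc ∑ s', trans M s a s' * V s' ≤ ∑ s', trans M s a s' * valueBound M :=
          Finset.sum_le_sum fun k _ => mul_le_mul_of_nonneg_left (hV k) (trans_nonneg M s a k)
      _ = valueBound M := by rw [← Finset.sum_mul, sum_trans, one_mul]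
  -- The bound is the fixed point of x ↦ cap + 2 + γx, so one Bellman backup preserves it.
  have h2 : (M.cap + 2 : ℝ) = (1 - M.disc) * valueBound M := by
    have : 1 - M.disc ≠ 0 := by linarith [M.disc_lt_one]
    unfold valueBound
    field_simp
  have h3 := mul_le_mul_of_nonneg_left h1 M.disc_pos.le
  have h4 := cost_le M s
  unfold qValue
  linarith

/-! ### Bellman operators, occupancy and the performance difference identity. -/

lemma bellmanPolicy_eq (p : Policy M) (V : State M → ℝ) :
    bellmanPolicy M p V = cost M + M.disc • (transMatrix M p).mulVec V := by
  funext s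
  simp only [bellmanPolicy, qValue, mul_add, Finset.sum_add_distrib, ← Finset.sum_mul, p.sum_one,
    one_mul, Pi.add_apply, Pi.smul_apply, smul_eq_mul, Matrix.mulVec, dotProduct, transMatrix_apply]
  congr 1
  simp only [Finset.sum_mul, Finset.mul_sum]
  rw [Finset.sum_comm]
  exact Finset.sum_congr rfl fun _ _ => Finset.sum_congr rfl fun _ _ => by ring

lemma bellmanPolicy_value (p : Policy M) :
    bellmanPolicy M p (value M p) = value M p := by
  have h : (1 - M.disc • transMatrix M p).mulVec (value M p) = cost M := by
    rw [value_eq, Matrix.mulVec_mulVec, mul_resolvent, Matrix.one_mulVec]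
  rw [bellmanPolicy_eq, ← h, Matrix.sub_mulVec, Matrix.one_mulVec, Matrix.smul_mulVec]
  abel

lemma occupancy_nonneg {ξ : State M → ℝ} (hξ : ∀ s, 0 ≤ ξ s) (p : Policy M) (s : State M) :
    0 ≤ occupancy M ξ p s := by
  rw [occupancy_eq]
  exact mul_nonneg (by linarith [M.disc_lt_one]) <|
    Finset.sum_nonneg fun k _ => mul_nonneg (hξ k) (resolvent_nonneg M p k s)

lemma sum_occupancy (ξ : State M → ℝ) (p : Policy M) :
    ∑ s, occupancy M ξ p s = ∑ s, ξ s := by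
  have h : 1 - M.disc ≠ 0 := by linarith [M.disc_lt_one]
  simp only [occupancy_eq, Pi.smul_apply, smul_eq_mul, Matrix.vecMul, dotProduct]
  rw [← Finset.mul_sum, Finset.sum_comm]
  simp only [← Finset.mul_sum, sum_resolvent]
  rw [← Finset.sum_mul, mul_comm, mul_assoc, inv_mul_cancel₀ h, mul_one]

/-- The chain starts from ξ, and time 0 carries weight 1 - γ. This transfers bounds under the
occupancy to bounds under ξ. -/
lemma le_occupancy {ξ : State M → ℝ} (hξ : ∀ s, 0 ≤ ξ s) (p : Policy M) (s : State M) :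
    (1 - M.disc) * ξ s ≤ occupancy M ξ p s := by
  rw [occupancy_eq]
  refine mul_le_mul_of_nonneg_left ?_ (by linarith [M.disc_lt_one])
  calc ξ s = Matrix.vecMul ξ 1 s := by rw [Matrix.vecMul_one]
    _ ≤ Matrix.vecMul ξ (resolvent M p) s :=
      Finset.sum_le_sum fun k _ => mul_le_mul_of_nonneg_left (one_le_resolvent M p k s) (hξ k)

/-- The performance difference lemma. -/
lemma sum_occupancy_mul_bellmanPolicy_sub (ξ V : State M → ℝ) (p : Policy M) :
    ∑ s, occupancy M ξ p s * (bellmanPolicy M p V s - V s) =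
      (1 - M.disc) * (J M ξ p - ∑ s, ξ s * V s) := by
  have h : bellmanPolicy M p V - V = cost M - (1 - M.disc • transMatrix M p).mulVec V := by
    rw [bellmanPolicy_eq, Matrix.sub_mulVec, Matrix.one_mulVec, Matrix.smul_mulVec]
    abel
  change occupancy M ξ p ⬝ᵥ (bellmanPolicy M p V - V) =
    (1 - M.disc) * (ξ ⬝ᵥ value M p - ξ ⬝ᵥ V)
  rw [h, occupancy_eq, smul_dotProduct, smul_eq_mul, ← Matrix.dotProduct_mulVec, Matrix.mulVec_sub,
    Matrix.mulVec_mulVec, resolvent_mul, Matrix.one_mulVec, ← value_eq, dotProduct_sub]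

/-! ### Smooth dependence on the policy parameter. -/

lemma contDiff_resolvent {p : ℝ → Policy M}
    (hp : ∀ s a, ContDiff ℝ 1 fun x => (p x).prob s a) :
    ContDiff ℝ 1 fun x => resolvent M (p x) := by
  have h1 : ContDiff ℝ 1 fun x => transMatrix M (p x) := by
    -- Expanding in elementary matrices reduces smoothness to that of the scalar entries.
    have h : (fun x => transMatrix M (p x)) = fun x => ∑ s, ∑ s',
        (∑ a, (p x).prob s a * trans M s a s') • Matrix.single s s' (1 : ℝ) := by
      funext x
      conv_lhs => rw [Matrix.matrix_eq_sum_single (transMatrix M (p x))]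
      simp [Matrix.smul_single, transMatrix_apply]
    rw [h]
    exact ContDiff.sum fun s _ => ContDiff.sum fun s' _ =>
      (ContDiff.sum fun a _ => (hp s a).mul contDiff_const).smul contDiff_const
  -- As the inverse of a unit, the resolvent inherits smoothness from ring inversion.
  have h2 : ∀ x, resolvent M (p x) = Ring.inverse (1 - M.disc • transMatrix M (p x)) := fun x =>
    (Ring.inverse_unit (⟨_, _, mul_resolvent M (p x), resolvent_mul M (p x)⟩ :
      (Matrix (State M) (State M) ℝ)ˣ)).symm
  simp only [h2]
  rw [contDiff_iff_contDiffAt]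
  intro x
  have h3 : ContDiff ℝ 1 fun x => 1 - M.disc • transMatrix M (p x) :=
    contDiff_const.sub (h1.const_smul M.disc)
  exact (contDiffAt_ringInverse ℝ (⟨_, _, mul_resolvent M (p x), resolvent_mul M (p x)⟩ :
      (Matrix (State M) (State M) ℝ)ˣ)).comp x h3.contDiffAt

lemma contDiff_value {p : ℝ → Policy M} (hp : ∀ s a, ContDiff ℝ 1 fun x => (p x).prob s a)
    (s : State M) : ContDiff ℝ 1 fun x => value M (p x) s := by
  simp only [value_eq]
  exact (LinearMap.toContinuousLinearMap (mulVecEntry M (cost M) s)).contDiff.comp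
    (contDiff_resolvent M hp)

lemma contDiff_occupancy {p : ℝ → Policy M} (hp : ∀ s a, ContDiff ℝ 1 fun x => (p x).prob s a)
    (ξ : State M → ℝ) (s : State M) : ContDiff ℝ 1 fun x => occupancy M ξ (p x) s := by
  simp only [occupancy_eq]
  exact contDiff_const.mul ((LinearMap.toContinuousLinearMap (vecMulEntry M ξ s)).contDiff.comp
    (contDiff_resolvent M hp))

lemma contDiff_bellmanPolicy {p : ℝ → Policy M}
    (hp : ∀ s a, ContDiff ℝ 1 fun x => (p x).prob s a) (V : State M → ℝ) (s : State M) :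
    ContDiff ℝ 1 fun x => bellmanPolicy M (p x) V s :=
  ContDiff.sum fun a _ => (hp s a).mul contDiff_const

/-! ### The logistic function and its density. -/

/-- The probability with which the soft threshold policy routes to server 2. -/
def logistic (σ l θ : ℝ) : ℝ := Real.exp (σ * (l - θ)) / (1 + Real.exp (σ * (l - θ)))

/-- The logistic density, without its normalizing factor `σ`. -/
def bump (σ l θ : ℝ) : ℝ := Real.exp (σ * (l - θ)) / (1 + Real.exp (σ * (l - θ))) ^ 2

lemma bump_pos (σ l θ : ℝ) : 0 < bump σ l θ := by
  unfold bump
  positivity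

lemma hasDerivAt_logistic (σ l θ : ℝ) : HasDerivAt (logistic σ l) (-σ * bump σ l θ) θ := by
  have h1 : HasDerivAt (fun x => Real.exp (σ * (l - x))) (Real.exp (σ * (l - θ)) * (σ * -1)) θ :=
    (((hasDerivAt_id θ).const_sub l).const_mul σ).exp
  have h2 : 1 + Real.exp (σ * (l - θ)) ≠ 0 := by positivity
  refine (h1.div (h1.const_add 1) h2).congr_deriv ?_
  unfold bump
  field_simp
  ring

lemma contDiff_logistic (σ l : ℝ) : ContDiff ℝ 1 (logistic σ l) := by
  have h : ContDiff ℝ 1 fun x : ℝ => Real.exp (σ * (l - x)) := by fun_prop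
  exact h.div (contDiff_const.add h) fun x => by positivity

/-- Total positivity of order two of the logistic density. -/
lemma bump_mul_bump_le {σ : ℝ} (hσ : 0 < σ) {l m x y : ℝ} (hlm : l ≤ m) (hxy : x ≤ y) :
    bump σ l y * bump σ m x ≤ bump σ l x * bump σ m y := by
  have hBA : Real.exp (σ * (l - y)) ≤ Real.exp (σ * (l - x)) :=
    Real.exp_le_exp.2 (mul_le_mul_of_nonneg_left (by linarith) hσ.le)
  have hAC : Real.exp (σ * (l - x)) ≤ Real.exp (σ * (m - x)) :=
    Real.exp_le_exp.2 (mul_le_mul_of_nonneg_left (by linarith) hσ.le)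
  have hprod : Real.exp (σ * (l - y)) * Real.exp (σ * (m - x)) =
      Real.exp (σ * (l - x)) * Real.exp (σ * (m - y)) := by
    rw [← Real.exp_add, ← Real.exp_add]
    congr 1
    ring
  have hA := Real.exp_pos (σ * (l - x))
  have hB := Real.exp_pos (σ * (l - y))
  have hC := Real.exp_pos (σ * (m - x))
  have hD := Real.exp_pos (σ * (m - y))
  unfold bump
  generalize Real.exp (σ * (l - x)) = A at *
  generalize Real.exp (σ * (l - y)) = B at *
  generalize Real.exp (σ * (m - x)) = C at *
  generalize Real.exp (σ * (m - y)) = D at *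
  -- With BC = AD, the difference A(B + C) - A(A + D) factors as (A - B)(C - A), which is
  -- nonnegative as B ≤ A ≤ C. The numerators of the claim agree, so only these sums matter.
  have hsum : A + D ≤ B + C := by
    have h : A * (A + D) ≤ A * (B + C) := by
      nlinarith [mul_nonneg (sub_nonneg.2 hBA) (sub_nonneg.2 hAC)]
    exact le_of_mul_le_mul_left h hA
  rw [div_mul_div_comm, div_mul_div_comm, hprod, ← mul_pow, ← mul_pow]
  have hle : (1 + A) * (1 + D) ≤ (1 + B) * (1 + C) := by nlinarith
  gcongr

/-- The parameter n + 1/2 is at distance at least 1/2 from every integer l, on the side prescribed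
by the hard threshold, and the logistic tail there is at most exp(-σ/2). -/
lemma abs_logistic_sub_le {σ : ℝ} (hσ : 0 < σ) (n l : ℕ) :
    |logistic σ l (n + 1 / 2) - (if n < l then 1 else 0)| ≤ Real.exp (-(σ / 2)) := by
  have hE := Real.exp_pos (σ * ((l : ℝ) - (n + 1 / 2)))
  unfold logistic
  split_ifs with h
  · have hl : (n : ℝ) + 1 ≤ l := by exact_mod_cast h
    have h1 : Real.exp (σ * ((l : ℝ) - (n + 1 / 2))) / (1 + Real.exp (σ * ((l : ℝ) - (n + 1 / 2)))) - 1
        = -(1 + Real.exp (σ * ((l : ℝ) - (n + 1 / 2))))⁻¹ := by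
      field_simp
      ring
    rw [h1, abs_neg, abs_of_pos (by positivity), Real.exp_neg]
    have h2 : Real.exp (σ / 2) ≤ Real.exp (σ * ((l : ℝ) - (n + 1 / 2))) :=
      Real.exp_le_exp.2 (by nlinarith)
    exact inv_anti₀ (Real.exp_pos _) (by linarith)
  · have hl : (l : ℝ) ≤ n := by exact_mod_cast not_lt.1 h
    rw [sub_zero, abs_of_pos (by positivity)]
    refine (div_le_self hE.le (by linarith)).trans (Real.exp_le_exp.2 (by nlinarith))

/-! ### The objective along soft policies and its stationary points. -/

lemma contDiff_soft_prob (σ : ℝ) (s : State M) (a : Action) :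
    ContDiff ℝ 1 fun x => (soft M σ x).prob s a := by
  have h := contDiff_logistic σ (s.1 : ℕ)
  simp only [soft, fastFirst]
  split_ifs
  any_goals exact contDiff_const
  · exact h
  · exact contDiff_const.sub h

/-- The weighted advantage of routing to server 2 over waiting, in the states in which server 1 is
busy and server 2 is idle. -/
def advantage (ν V : State M → ℝ) (s : State M) : ℝ :=
  if s.2 = (true, false) then ν s * (qValue M V s 2 - qValue M V s 0) else 0

/-- Two such policies differ only with server 1 busy and server 2 idle, and the objective is affine
in the routing probabilities. -/
lemma B_fastFirst_sub (ν V : State M → ℝ) (r r' : ℕ → ℝ) (hr : ∀ l, 0 ≤ r l ∧ r l ≤ 1)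
    (hr' : ∀ l, 0 ≤ r' l ∧ r' l ≤ 1) :
    B M (fastFirst M r hr) ν V - B M (fastFirst M r' hr') ν V =
      ∑ s, advantage M ν V s * (r s.1 - r' s.1) := by
  unfold B
  rw [← Finset.sum_sub_distrib]
  refine Finset.sum_congr rfl fun s _ => ?_
  obtain ⟨l, b₁, b₂⟩ := s
  cases b₁ <;> cases b₂ <;>
    simp [advantage, bellmanPolicy, fastFirst, Fin.sum_univ_three]
  ring

lemma hasDerivAt_B_soft (σ : ℝ) (ν V : State M → ℝ) (x : ℝ) :
    HasDerivAt (fun y => B M (soft M σ y) ν V)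
      (-σ * ∑ s, advantage M ν V s * bump σ (s.1 : ℕ) x) x := by
  have h : (fun y => B M (soft M σ y) ν V) = fun y => B M (soft M σ x) ν V +
      ∑ s, advantage M ν V s * (logistic σ (s.1 : ℕ) y - logistic σ (s.1 : ℕ) x) := by
    funext y
    exact eq_add_of_sub_eq' (B_fastFirst_sub M ν V _ _ _ _)
  rw [h]
  refine (HasDerivAt.fun_sum fun s _ => ((hasDerivAt_logistic σ (s.1 : ℕ) x).sub_const
    (logistic σ (s.1 : ℕ) x)).const_mul (advantage M ν V s)).const_add _ |>.congr_deriv ?_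
  rw [Finset.mul_sum]
  exact Finset.sum_congr rfl fun _ _ => by ring

/-- Variation diminishing: divided by the density centred at the crossing level n, the weighted sum
is nonincreasing in the parameter, so it can pass only from positive to negative. Each term obeys
the inequality separately, since the weight flips sign exactly where total positivity flips
direction. -/
lemma sum_advantage_mul_bump_le {σ : ℝ} (hσ : 0 < σ) {w : State M → ℝ} {n : ℕ}
    (hpos : ∀ s, (s.1 : ℕ) ≤ n → 0 ≤ w s) (hneg : ∀ s, n < (s.1 : ℕ) → w s ≤ 0) {x y : ℝ}
    (hxy : x ≤ y) :
    (∑ s, w s * bump σ (s.1 : ℕ) y) * bump σ n x ≤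
      (∑ s, w s * bump σ (s.1 : ℕ) x) * bump σ n y := by
  rw [Finset.sum_mul, Finset.sum_mul]
  refine Finset.sum_le_sum fun s _ => ?_
  rw [mul_assoc, mul_assoc]
  rcases le_or_gt (s.1 : ℕ) n with h | h
  · exact mul_le_mul_of_nonneg_left (bump_mul_bump_le hσ (Nat.cast_le.2 h) hxy) (hpos s h)
  · refine mul_le_mul_of_nonpos_left ?_ (hneg s h)
    exact (mul_comm _ _).trans_le
      ((bump_mul_bump_le hσ (Nat.cast_le.2 h.le) hxy).trans_eq (mul_comm _ _))

lemma dispatch_of_empty {s : State M} (hs : (s.1 : ℕ) = 0) (a : Action) :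
    dispatch M s a = s := by
  simp [dispatch, hs]

/-- Covers l = 0, about which single crossing says nothing. -/
lemma advantage_of_empty (ν V : State M → ℝ) {s : State M} (hs : (s.1 : ℕ) = 0) :
    advantage M ν V s = 0 := by
  simp [advantage, qValue, trans, dispatch_of_empty M hs]

/-- If the weighted sum vanishes at x, it is nonpositive to the right and nonnegative to the left;
the factor -σ makes the objective decrease up to x and increase beyond it. -/
lemma le_of_sum_advantage_mul_bump_eq_zero {σ : ℝ} (hσ : 0 < σ) {ν V : State M → ℝ} {n : ℕ}
    (hpos : ∀ s, (s.1 : ℕ) ≤ n → 0 ≤ advantage M ν V s)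
    (hneg : ∀ s, n < (s.1 : ℕ) → advantage M ν V s ≤ 0) {x : ℝ}
    (hx : ∑ s, advantage M ν V s * bump σ (s.1 : ℕ) x = 0) (y : ℝ) :
    B M (soft M σ x) ν V ≤ B M (soft M σ y) ν V := by
  have hd : Differentiable ℝ fun y => B M (soft M σ y) ν V := fun y =>
    (hasDerivAt_B_soft M σ ν V y).differentiableAt
  rcases le_total x y with hxy | hxy
  · refine monotoneOn_of_deriv_nonneg (convex_Ici x) hd.continuous.continuousOn
      hd.differentiableOn (fun z hz => ?_) Set.self_mem_Ici hxy hxy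
    rw [interior_Ici] at hz
    have h := sum_advantage_mul_bump_le M hσ hpos hneg (Set.mem_Ioi.1 hz).le
    rw [hx, zero_mul] at h
    rw [(hasDerivAt_B_soft M σ ν V z).deriv]
    nlinarith [nonpos_of_mul_nonpos_left h (bump_pos σ n x)]
  · refine antitoneOn_of_deriv_nonpos (convex_Iic x) hd.continuous.continuousOn
      hd.differentiableOn (fun z hz => ?_) hxy Set.self_mem_Iic hxy
    rw [interior_Iic] at hz
    have h := sum_advantage_mul_bump_le M hσ hpos hneg (Set.mem_Iio.1 hz).le
    rw [hx, zero_mul] at h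
    rw [(hasDerivAt_B_soft M σ ν V z).deriv]
    nlinarith [nonneg_of_mul_nonneg_left h (bump_pos σ n x)]

lemma noSuboptimalStationary_of_singleCrossing {σ : ℝ} (hσ : 0 < σ) {ξ : State M → ℝ}
    (hξ : ∀ s, 0 ≤ ξ s) {θ : ℝ} (h : SingleCrossing M σ θ) : NoSuboptimalStationary M σ ξ θ := by
  obtain ⟨n, hn⟩ := h
  intro x hx y
  unfold piObjective at hx
  rw [(hasDerivAt_B_soft M σ _ _ x).deriv, mul_eq_zero, neg_eq_zero] at hx
  refine le_of_sum_advantage_mul_bump_eq_zero M (n := n) hσ (fun s hs => ?_) (fun s hs => ?_)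
    (hx.resolve_left hσ.ne') y
  · rcases Nat.eq_zero_or_pos (s.1 : ℕ) with h0 | h0
    · rw [advantage_of_empty M _ _ h0]
    · obtain ⟨l, b⟩ := s
      unfold advantage
      split_ifs with hb
      · obtain rfl : b = (true, false) := hb
        exact mul_nonneg (occupancy_nonneg M hξ _ _) (sub_nonneg.2 ((hn l h0).1 hs))
      · rfl
  · obtain ⟨l, b⟩ := s
    unfold advantage
    split_ifs with hb
    · obtain rfl : b = (true, false) := hb
      exact mul_nonpos_of_nonneg_of_nonpos (occupancy_nonneg M hξ _ _)
        (sub_nonpos.2 ((hn l (Nat.one_le_of_lt hs)).2 hs))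
    · rfl

/-! ### Inherent Bellman errors: the uniform bound and the sharp limit. -/

lemma bellmanPolicy_nonneg (p : Policy M) {V : State M → ℝ} (hV : ∀ s, 0 ≤ V s) (s : State M) :
    0 ≤ bellmanPolicy M p V s :=
  Finset.sum_nonneg fun a _ => mul_nonneg (p.nonneg s a) (qValue_nonneg M V hV s a)

lemma bellmanPolicy_le (p : Policy M) {V : State M → ℝ} (hV : ∀ s, V s ≤ valueBound M)
    (s : State M) : bellmanPolicy M p V s ≤ valueBound M := by
  calc bellmanPolicy M p V s ≤ ∑ a, p.prob s a * valueBound M :=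
        Finset.sum_le_sum fun a _ => mul_le_mul_of_nonneg_left (qValue_le M V hV s a) (p.nonneg s a)
    _ = valueBound M := by rw [← Finset.sum_mul, p.sum_one, one_mul]

lemma piObjective_nonneg (σ : ℝ) {ξ : State M → ℝ} (hξ : ∀ s, 0 ≤ ξ s) (θ : ℝ) (p : Policy M) :
    0 ≤ piObjective M σ ξ θ p :=
  Finset.sum_nonneg fun s _ => mul_nonneg (occupancy_nonneg M hξ _ s)
    (bellmanPolicy_nonneg M p (value_nonneg M _) s)

lemma piObjective_le (σ : ℝ) {ξ : State M → ℝ} (hξ : ξ ∈ stdSimplex ℝ (State M)) (θ : ℝ)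
    (p : Policy M) : piObjective M σ ξ θ p ≤ valueBound M := by
  calc piObjective M σ ξ θ p ≤ ∑ s, occupancy M ξ (soft M σ θ) s * valueBound M :=
        Finset.sum_le_sum fun s _ => mul_le_mul_of_nonneg_left
          (bellmanPolicy_le M p (value_le M _) s) (occupancy_nonneg M hξ.1 _ s)
    _ = valueBound M := by rw [← Finset.sum_mul, sum_occupancy, hξ.2, one_mul]

instance nonempty_policy : Nonempty (Policy M) := ⟨hard M 0⟩

lemma bddBelow_piObjective_soft (σ : ℝ) {ξ : State M → ℝ} (hξ : ∀ s, 0 ≤ ξ s) (θ : ℝ) :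
    BddBelow (Set.range fun x => piObjective M σ ξ θ (soft M σ x)) :=
  ⟨0, by rintro _ ⟨x, rfl⟩; exact piObjective_nonneg M σ hξ θ _⟩

/-- Every policy has its objective between 0 and the value bound, so any soft policy, here the one
with parameter 0, is good enough. -/
lemma closedUpTo_valueBound (σ : ℝ) {ξ : State M → ℝ} (hξ : ξ ∈ stdSimplex ℝ (State M)) (θ : ℝ) :
    ClosedUpTo M σ ξ θ (valueBound M) := by
  have h1 := (ciInf_le (bddBelow_piObjective_soft M σ hξ.1 θ) 0).trans (piObjective_le M σ hξ θ _)
  have h2 : 0 ≤ ⨅ p : Policy M, piObjective M σ ξ θ p :=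
    Real.iInf_nonneg fun p => piObjective_nonneg M σ hξ.1 θ p
  unfold ClosedUpTo
  linarith

lemma sum_abs_advantage_le {ν V : State M → ℝ} (hν : ∀ s, 0 ≤ ν s) (hV : ∀ s, 0 ≤ V s)
    (hV' : ∀ s, V s ≤ valueBound M) :
    ∑ s, |advantage M ν V s| ≤ (∑ s, ν s) * valueBound M := by
  rw [Finset.sum_mul]
  refine Finset.sum_le_sum fun s _ => ?_
  unfold advantage
  split_ifs
  · rw [abs_mul, abs_of_nonneg (hν s)]
    refine mul_le_mul_of_nonneg_left ?_ (hν s)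
    exact abs_sub_le_of_nonneg_of_le (qValue_nonneg M V hV s 2) (qValue_le M V hV' s 2)
      (qValue_nonneg M V hV s 0) (qValue_le M V hV' s 0)
  · rw [abs_zero]
    exact mul_nonneg (hν s) (valueBound_nonneg M)

/-- Replacing the hard threshold n by the soft policy at n + 1/2 changes each routing probability by
at most exp(-σ/2), and the absolute advantages sum to at most the value bound. -/
lemma closedUpTo_of_thresholdImproves {σ : ℝ} (hσ : 0 < σ) {ξ : State M → ℝ}
    (hξ : ξ ∈ stdSimplex ℝ (State M)) {θ : ℝ} (h : ThresholdImproves M σ ξ θ) :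
    ClosedUpTo M σ ξ θ (valueBound M * Real.exp (-(σ / 2))) := by
  obtain ⟨n, hn⟩ := h
  have h1 := ciInf_le (bddBelow_piObjective_soft M σ hξ.1 θ) ((n : ℝ) + 1 / 2)
  have h2 : piObjective M σ ξ θ (hard M n) ≤ ⨅ p : Policy M, piObjective M σ ξ θ p := le_ciInf hn
  have h3 : piObjective M σ ξ θ (soft M σ (n + 1 / 2)) - piObjective M σ ξ θ (hard M n) ≤
      valueBound M * Real.exp (-(σ / 2)) := by
    have hadv := sum_abs_advantage_le M (occupancy_nonneg M hξ.1 (soft M σ θ))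
      (value_nonneg M (soft M σ θ)) (value_le M (soft M σ θ))
    rw [sum_occupancy, hξ.2, one_mul] at hadv
    refine (B_fastFirst_sub M _ _ _ _ _ _).trans_le ?_
    refine le_trans ?_ (mul_le_mul_of_nonneg_right hadv (Real.exp_pos _).le)
    rw [Finset.sum_mul]
    refine Finset.sum_le_sum fun s _ => (le_abs_self _).trans ?_
    rw [abs_mul]
    exact mul_le_mul_of_nonneg_left (abs_logistic_sub_le hσ n s.1) (abs_nonneg _)
  unfold ClosedUpTo
  linarith

/-! ### Policy gradient and the optimality gap. -/

/-- The policy gradient theorem for soft threshold policies: up to the factor `1 - γ`, the cost and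
the weighted policy iteration objective at `π_θ` have the same derivative at `θ`. -/
lemma deriv_J_soft (σ : ℝ) (ξ : State M → ℝ) (θ : ℝ) :
    (1 - M.disc) * deriv (fun x => J M ξ (soft M σ x)) θ =
      deriv (fun x => piObjective M σ ξ θ (soft M σ x)) θ := by
  set V := value M (soft M σ θ) with hV
  have hν : ∀ s, HasDerivAt (fun x => occupancy M ξ (soft M σ x) s)
      (deriv (fun x => occupancy M ξ (soft M σ x) s) θ) θ := fun s =>
    ((contDiff_occupancy M (contDiff_soft_prob M σ) ξ s).differentiable one_ne_zero θ).hasDerivAt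
  have hT : ∀ s, HasDerivAt (fun x => bellmanPolicy M (soft M σ x) V s)
      (deriv (fun x => bellmanPolicy M (soft M σ x) V s) θ) θ := fun s =>
    ((contDiff_bellmanPolicy M (contDiff_soft_prob M σ) V s).differentiable
      one_ne_zero θ).hasDerivAt
  have h1 : HasDerivAt (fun x => ∑ s, occupancy M ξ (soft M σ x) s *
      (bellmanPolicy M (soft M σ x) V s - V s))
      (∑ s, occupancy M ξ (soft M σ θ) s *
        deriv (fun x => bellmanPolicy M (soft M σ x) V s) θ) θ := by
    refine (HasDerivAt.fun_sum fun s _ => (hν s).mul ((hT s).sub_const (V s))).congr_deriv ?_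
    refine Finset.sum_congr rfl fun s _ => ?_
    -- V is the fixed point of the Bellman operator at θ, which kills the term with the derivative
    -- of the occupancy.
    rw [hV, bellmanPolicy_value, sub_self, mul_zero, zero_add]
  have h2 : HasDerivAt (fun x => piObjective M σ ξ θ (soft M σ x))
      (∑ s, occupancy M ξ (soft M σ θ) s *
        deriv (fun x => bellmanPolicy M (soft M σ x) V s) θ) θ :=
    HasDerivAt.fun_sum fun s _ => (hT s).const_mul _
  have hγ : 1 - M.disc ≠ 0 := by linarith [M.disc_lt_one]
  have h3 : (fun x => J M ξ (soft M σ x)) = fun x => (1 - M.disc)⁻¹ *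
      (∑ s, occupancy M ξ (soft M σ x) s * (bellmanPolicy M (soft M σ x) V s - V s)) +
      ∑ s, ξ s * V s := by
    funext x
    rw [sum_occupancy_mul_bellmanPolicy_sub, inv_mul_cancel_left₀ hγ, sub_add_cancel]
  rw [h2.deriv, h3, ((h1.const_mul _).add_const _).deriv, mul_inv_cancel_left₀ hγ]

lemma exists_bellmanPolicy_eq_bellman (V : State M → ℝ) :
    ∃ p : Policy M, bellmanPolicy M p V = bellman M V := by
  choose g hg using fun s => exists_eq_ciInf_of_finite (f := fun a => qValue M V s a)
  refine ⟨⟨fun s a => if a = g s then 1 else 0, fun s a => by positivity, fun s => by simp⟩, ?_⟩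
  funext s
  simp only [bellmanPolicy, ite_mul, one_mul, zero_mul, Finset.sum_ite_eq', Finset.mem_univ,
    if_true]
  exact hg s

lemma bellman_le_bellmanPolicy (p : Policy M) (V : State M → ℝ) (s : State M) :
    bellman M V s ≤ bellmanPolicy M p V s := by
  calc bellman M V s = ∑ a, p.prob s a * bellman M V s := by
        rw [← Finset.sum_mul, p.sum_one, one_mul]
    _ ≤ bellmanPolicy M p V s := Finset.sum_le_sum fun a _ => mul_le_mul_of_nonneg_left
        (ciInf_le (Set.finite_range _).bddBelow a) (p.nonneg s a)

/-- Only this direction is needed, so no policy optimal in all states at once has to be constructed.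
-/
lemma sum_mul_valueOpt_le_Jopt {ξ : State M → ℝ} (hξ : ∀ s, 0 ≤ ξ s) :
    ∑ s, ξ s * valueOpt M s ≤ Jopt M ξ :=
  le_ciInf fun p => Finset.sum_le_sum fun s _ => mul_le_mul_of_nonneg_left
    (ciInf_le ⟨0, by rintro _ ⟨q, rfl⟩; exact value_nonneg M q s⟩ p) (hξ s)

/-- The greedy policy attains TV, so the gap of the objective between it and π_θ is exactly the
residual V - TV averaged over the occupancy. The residual is nonnegative, which allows the occupancy
to be replaced by its lower bound (1 - γ)ξ. -/
lemma norm1_sub_bellman_le {σ : ℝ} {ξ : State M → ℝ} (hξ : ∀ s, 0 ≤ ξ s) {θ ε : ℝ}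
    (hθ : ∀ y, piObjective M σ ξ θ (soft M σ θ) ≤ piObjective M σ ξ θ (soft M σ y))
    (hε : ClosedUpTo M σ ξ θ ε) :
    (1 - M.disc) * norm1 M ξ
      (fun s => value M (soft M σ θ) s - bellman M (value M (soft M σ θ)) s) ≤ ε := by
  set V := value M (soft M σ θ) with hV
  have hle : ∀ s, bellman M V s ≤ V s := fun s =>
    (bellman_le_bellmanPolicy M (soft M σ θ) V s).trans_eq (congrFun (bellmanPolicy_value M _) s)
  obtain ⟨p, hp⟩ := exists_bellmanPolicy_eq_bellman M V
  have h1 : (⨅ q : Policy M, piObjective M σ ξ θ q) ≤ piObjective M σ ξ θ p :=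
    ciInf_le ⟨0, by rintro _ ⟨q, rfl⟩; exact piObjective_nonneg M σ hξ θ q⟩ p
  have h2 : piObjective M σ ξ θ (soft M σ θ) - piObjective M σ ξ θ p ≤ ε := by
    have h3 := le_ciInf hθ
    unfold ClosedUpTo at hε
    linarith
  refine le_trans ?_ h2
  unfold piObjective B norm1
  rw [← Finset.sum_sub_distrib, Finset.mul_sum]
  refine Finset.sum_le_sum fun s _ => ?_
  rw [← hV, hp, abs_of_nonneg (sub_nonneg.2 (hle s)), ← mul_sub, hV, bellmanPolicy_value,
    ← mul_assoc]
  exact mul_le_mul_of_nonneg_right (le_occupancy M hξ _ s) (sub_nonneg.2 (hle s))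

lemma J_sub_Jopt_le {σ : ℝ} {ξ : State M → ℝ} (hξ : ∀ s, 0 ≤ ξ s) {κ θ ε : ℝ}
    (hκ : IsConcentrability M σ ξ κ)
    (hθ : ∀ y, piObjective M σ ξ θ (soft M σ θ) ≤ piObjective M σ ξ θ (soft M σ y))
    (hε : ClosedUpTo M σ ξ θ ε) :
    (1 - M.disc) * (J M ξ (soft M σ θ) - Jopt M ξ) ≤ κ / (1 - M.disc) * ε := by
  have hγ : 0 < 1 - M.disc := by linarith [M.disc_lt_one]
  have h1 : J M ξ (soft M σ θ) - Jopt M ξ ≤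
      norm1 M ξ (fun s => value M (soft M σ θ) s - valueOpt M s) := by
    calc J M ξ (soft M σ θ) - Jopt M ξ
        ≤ J M ξ (soft M σ θ) - ∑ s, ξ s * valueOpt M s :=
          sub_le_sub_left (sum_mul_valueOpt_le_Jopt M hξ) _
      _ = ∑ s, ξ s * (value M (soft M σ θ) s - valueOpt M s) := by
          simp only [J, mul_sub, Finset.sum_sub_distrib]
      _ ≤ _ := Finset.sum_le_sum fun s _ => mul_le_mul_of_nonneg_left (le_abs_self _) (hξ s)
  calc (1 - M.disc) * (J M ξ (soft M σ θ) - Jopt M ξ)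
      ≤ (1 - M.disc) * (κ / (1 - M.disc) * norm1 M ξ
          (fun s => value M (soft M σ θ) s - bellman M (value M (soft M σ θ)) s)) :=
        mul_le_mul_of_nonneg_left (h1.trans (hκ.1.2 θ)) hγ.le
    _ = κ / (1 - M.disc) * ((1 - M.disc) * norm1 M ξ
          (fun s => value M (soft M σ θ) s - bellman M (value M (soft M σ θ)) s)) :=
        mul_left_comm _ _ _
    _ ≤ κ / (1 - M.disc) * ε :=
        mul_le_mul_of_nonneg_left (norm1_sub_bellman_le M hξ hθ hε) (div_nonneg hκ.1.1 hγ.le)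

end TwoServer

end

theorem theorem2 (M : TwoServer.Queue) (ξ : TwoServer.State M → ℝ)
    (hξ : ξ ∈ stdSimplex ℝ (TwoServer.State M)) :
    -- the statements about a fixed sharpness `σ`
    (∀ σ : ℝ, 0 < σ →
      -- `J_γ` is continuously differentiable
      ContDiff ℝ 1 (fun θ : ℝ => TwoServer.J M ξ (TwoServer.soft M σ θ)) ∧
      -- differentiability of the weighted policy iteration objective in both parameters
      (∀ θ : ℝ,
        ContDiff ℝ 1 (fun x : ℝ => TwoServer.B M (TwoServer.soft M σ x)
          (TwoServer.occupancy M ξ (TwoServer.soft M σ θ))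
          (TwoServer.value M (TwoServer.soft M σ θ))) ∧
        ContDiff ℝ 1 (fun x : ℝ => TwoServer.B M (TwoServer.soft M σ θ)
          (TwoServer.occupancy M ξ (TwoServer.soft M σ x))
          (TwoServer.value M (TwoServer.soft M σ θ)))) ∧
      -- closure under approximate policy improvement, with a finite error
      (∃ ε : ℝ, 0 ≤ ε ∧ ∀ θ : ℝ, TwoServer.ClosedUpTo M σ ξ θ ε) ∧
      -- single crossing excludes sub-optimal stationary points
      (∀ θ : ℝ, TwoServer.SingleCrossing M σ θ → TwoServer.NoSuboptimalStationary M σ ξ θ) ∧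
      -- approximate optimality of the stationary points of `J_γ`
      (∀ κ : ℝ, TwoServer.IsConcentrability M σ ξ κ →
        ∀ θ : ℝ, TwoServer.NoSuboptimalStationary M σ ξ θ →
          deriv (fun x : ℝ => TwoServer.J M ξ (TwoServer.soft M σ x)) θ = 0 →
          ∀ ε : ℝ, 0 ≤ ε → TwoServer.ClosedUpTo M σ ξ θ ε →
            (1 - M.disc) * (TwoServer.J M ξ (TwoServer.soft M σ θ) - TwoServer.Jopt M ξ) ≤
              κ / (1 - M.disc) * ε)) ∧
    -- the error tends to `0` as the sharpness grows, where policy improvement is of threshold type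
    (∃ ε : ℝ → ℝ, Tendsto ε atTop (𝓝 0) ∧ ∀ σ : ℝ, 0 < σ → 0 ≤ ε σ ∧
      ∀ θ : ℝ, TwoServer.ThresholdImproves M σ ξ θ → TwoServer.ClosedUpTo M σ ξ θ (ε σ)) := by
  refine ⟨fun σ hσ => ⟨?_, fun θ => ⟨?_, ?_⟩,
    ⟨TwoServer.valueBound M, TwoServer.valueBound_nonneg M,
      TwoServer.closedUpTo_valueBound M σ hξ⟩,
    fun θ => TwoServer.noSuboptimalStationary_of_singleCrossing M hσ hξ.1, ?_⟩,
    fun σ => TwoServer.valueBound M * Real.exp (-(σ / 2)), ?_, fun σ hσ =>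
      ⟨mul_nonneg (TwoServer.valueBound_nonneg M) (Real.exp_pos _).le,
        fun θ => TwoServer.closedUpTo_of_thresholdImproves M hσ hξ⟩⟩
  · exact ContDiff.sum fun s _ => contDiff_const.mul
      (TwoServer.contDiff_value M (TwoServer.contDiff_soft_prob M σ) s)
  · exact ContDiff.sum fun s _ => contDiff_const.mul
      (TwoServer.contDiff_bellmanPolicy M (TwoServer.contDiff_soft_prob M σ) _ s)
  · exact ContDiff.sum fun s _ => (TwoServer.contDiff_occupancy M
      (TwoServer.contDiff_soft_prob M σ) ξ s).mul contDiff_const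
  · intro κ hκ θ hθ hJ ε _ hε
    refine TwoServer.J_sub_Jopt_le M hξ.1 hκ (hθ θ ?_) hε
    rw [← TwoServer.deriv_J_soft, hJ, mul_zero]
  · rw [← mul_zero (TwoServer.valueBound M)]
    exact (Real.tendsto_exp_neg_atTop_nhds_zero.comp
      (tendsto_id.atTop_div_const two_pos)).const_mul _
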